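/- For non-negative integers $m,n$ let \[C(m,n)=\frac{(2m)!\,(2n)!}{m!\,(m+n)!\,n!}\] be the bivariate Catalan number, and define the central Catalan numbers, for integers $h\ge 0$, by \[C_1(h)=\tfrac12 C(2h+1,h+1),\quad C_2(h)=\tfrac12 C(2h,h+1),\quad C_3(h)=\tfrac12 C(2h,h),\quad C_4(h)=\tfrac12 C(2h+1,h).\] Then for every positive integer $h$, \[\sum_{j=0}^{h} C_3(j)C_3(h-j)=2\sum_{j=0}^{h-1}C_2(j)C_1(h-1-j),\] \[\sum_{j=0}^{h} C_3(j)C_4(h-j)=\sum_{j=0}^{h}C_2(j)C_3(h-j)+\sum_{j=0}^{h-1}C_1(j)C_1(h-1-j),\] \[\sum_{j=0}^{h} C_4(j)C_4(h-j)=2\sum_{j=0}^{h}C_3(j)C_1(h-j).\] -/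

import Mathlib

open scoped Nat

/-- The bivariate Catalan number `C(m,n) = (2m)! (2n)! / (m! (m+n)! n!)`. -/
def bivariateCatalan (m n : ℕ) : ℚ :=
  (((2 * m)! : ℚ) * ((2 * n)! : ℚ)) / ((m ! : ℚ) * ((m + n)! : ℚ) * (n ! : ℚ))

/-- The first central Catalan numbers, `C₁(h) = C(2h+1,h+1)/2`. -/
def centralCatalan₁ (h : ℕ) : ℚ := (1 / 2 : ℚ) * bivariateCatalan (2 * h + 1) (h + 1)

/-- The second central Catalan numbers, `C₂(h) = C(2h,h+1)/2`. -/
def centralCatalan₂ (h : ℕ) : ℚ := (1 / 2 : ℚ) * bivariateCatalan (2 * h) (h + 1)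

/-- The third central Catalan numbers, `C₃(h) = C(2h,h)/2`. -/
def centralCatalan₃ (h : ℕ) : ℚ := (1 / 2 : ℚ) * bivariateCatalan (2 * h) h

/-- The fourth central Catalan numbers, `C₄(h) = C(2h+1,h)/2`. -/
def centralCatalan₄ (h : ℕ) : ℚ := (1 / 2 : ℚ) * bivariateCatalan (2 * h + 1) h

/-! Let `B_r` be the generating function of `(4h + r).choose h`. The central Catalan series are
`B_2`, `B_1 - 2 X B_4`, `B_0 / 2` and `B_1`. Since `B_r B_s` depends only on `r + s`
(`quarticBinomialSeries_mul_succ`), the last two convolution identities reduce to `B_0 B_4 = B_2 ^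
2` and `B_1 ^ 2 = B_0 B_2`. The first comes from squaring `B_0 - 4 X B_3 = 1`. -/

open PowerSeries in
/-- The generating function of the binomial coefficients `(4h + r).choose h`. -/
noncomputable def quarticBinomialSeries (r : ℕ) : PowerSeries ℚ :=
  PowerSeries.mk fun h => ((4 * h + r).choose h : ℚ)

open PowerSeries in
theorem quarticBinomialSeries_succ (r : ℕ) :
    quarticBinomialSeries (r + 1)
      = quarticBinomialSeries r + X * quarticBinomialSeries (r + 4) := by
  ext h
  cases h with
  | zero => simp [quarticBinomialSeries]
  | succ h =>
    rw [map_add, coeff_succ_X_mul]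
    simp only [quarticBinomialSeries, coeff_mk]
    rw [← add_assoc, Nat.choose_succ_succ, show 4 * h + (r + 4) = 4 * (h + 1) + r by ring]
    push_cast
    ring

-- Absorption: `(h + 1) * (4h + 4).choose (h + 1) = (4h + 4) * (4h + 3).choose h`; cancelling `h +
-- 1` leaves the factor 4.
open PowerSeries in
theorem quarticBinomialSeries_zero :
    quarticBinomialSeries 0 = 1 + 4 * (X * quarticBinomialSeries 3) := by
  have h4 : (4 : PowerSeries ℚ) = C 4 := (map_ofNat C 4).symm
  ext h
  rw [h4, map_add, coeff_C_mul]
  cases h with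
  | zero => simp [quarticBinomialSeries]
  | succ h =>
    rw [coeff_succ_X_mul]
    simp only [quarticBinomialSeries, coeff_mk, coeff_one, add_zero]
    have key := Nat.add_one_mul_choose_eq (4 * h + 3) h
    have key' : ((4 * h + 3 + 1 : ℕ) : ℚ) * ((4 * h + 3).choose h : ℚ)
        = ((4 * h + 3 + 1).choose (h + 1) : ℚ) * ((h + 1 : ℕ) : ℚ) := by exact_mod_cast key
    rw [show 4 * (h + 1) = 4 * h + 3 + 1 by ring, if_neg (by omega), zero_add]
    have hpos : ((h : ℚ) + 1) ≠ 0 := by positivity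
    apply mul_right_cancel₀ hpos
    push_cast at key' ⊢
    linarith

open PowerSeries in
/-- The product of two quartic binomial series depends only on the sum of their parameters. -/
theorem quarticBinomialSeries_mul_succ (r s : ℕ) :
    quarticBinomialSeries r * quarticBinomialSeries (s + 1)
      = quarticBinomialSeries (r + 1) * quarticBinomialSeries s := by
  have step : ∀ r s : ℕ,
      quarticBinomialSeries r * quarticBinomialSeries (s + 1)
        - quarticBinomialSeries (r + 1) * quarticBinomialSeries s
      = X * (quarticBinomialSeries r * quarticBinomialSeries (s + 4)
        - quarticBinomialSeries (r + 4) * quarticBinomialSeries s) := fun r s => by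
    rw [quarticBinomialSeries_succ r, quarticBinomialSeries_succ s]
    ring
  have vanish : ∀ n r s : ℕ,
      coeff n (quarticBinomialSeries r * quarticBinomialSeries (s + 1)
        - quarticBinomialSeries (r + 1) * quarticBinomialSeries s) = 0 := by
    intro n
    induction n with
    | zero => intro r s; rw [step]; simp
    | succ n ih =>
      intro r s
      rw [step, coeff_succ_X_mul]
      -- Moving four units from one index to the other telescopes into four unit moves, each
      -- vanishing in degree `n`.
      have h0 := ih r (s + 3)
      have h1 := ih (r + 1) (s + 2)
      have h2 := ih (r + 2) (s + 1)
      have h3 := ih (r + 3) s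
      simp only [map_sub, add_assoc, Nat.reduceAdd] at h0 h1 h2 h3 ⊢
      linarith
  rw [← sub_eq_zero]
  ext n
  rw [vanish, map_zero]

theorem centralCatalan₁_eq (h : ℕ) : centralCatalan₁ h = ((4 * h + 2).choose h : ℚ) := by
  rw [Nat.cast_choose ℚ (by omega : h ≤ 4 * h + 2), centralCatalan₁, bivariateCatalan,
    show 4 * h + 2 - h = 2 * h + 1 + (h + 1) by omega,
    show 2 * (2 * h + 1) = 4 * h + 2 by ring, show 2 * (h + 1) = 2 * h + 1 + 1 by ring,
    Nat.factorial_succ (2 * h + 1), Nat.factorial_succ h]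
  push_cast
  have := Nat.factorial_ne_zero
  field_simp
  ring

theorem centralCatalan₃_eq (h : ℕ) : centralCatalan₃ h = 1 / 2 * ((4 * h).choose h : ℚ) := by
  rw [Nat.cast_choose ℚ (by omega : h ≤ 4 * h), centralCatalan₃, bivariateCatalan,
    show 4 * h - h = 2 * h + h by omega, show 2 * (2 * h) = 4 * h by ring]
  field_simp

theorem centralCatalan₄_eq (h : ℕ) : centralCatalan₄ h = ((4 * h + 1).choose h : ℚ) := by
  rw [Nat.cast_choose ℚ (by omega : h ≤ 4 * h + 1), centralCatalan₄, bivariateCatalan,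
    show 4 * h + 1 - h = 2 * h + 1 + h by omega,
    show 2 * (2 * h + 1) = 4 * h + 1 + 1 by ring,
    Nat.factorial_succ (2 * h), Nat.factorial_succ (4 * h + 1)]
  push_cast
  field_simp
  ring

theorem centralCatalan₂_zero : centralCatalan₂ 0 = 1 := by
  norm_num [centralCatalan₂, bivariateCatalan, Nat.factorial]

/-- Both sides are `(4h + 4)! / ((h + 1)! (3h + 4)!)` times `2h + 3 = (4h + 5) - 2 (h + 1)`. -/
theorem centralCatalan₂_succ (h : ℕ) :
    centralCatalan₂ (h + 1)
      = ((4 * (h + 1) + 1).choose (h + 1) : ℚ) - 2 * ((4 * h + 4).choose h : ℚ) := by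
  rw [Nat.cast_choose ℚ (by omega : h + 1 ≤ 4 * (h + 1) + 1),
    Nat.cast_choose ℚ (by omega : h ≤ 4 * h + 4), centralCatalan₂, bivariateCatalan,
    show 4 * (h + 1) + 1 - (h + 1) = 3 * h + 4 by omega,
    show 4 * h + 4 - h = 3 * h + 4 by omega,
    show 2 * (2 * (h + 1)) = 4 * h + 4 by ring,
    show 2 * (h + 1) + (h + 1 + 1) = 3 * h + 4 by ring,
    show 4 * (h + 1) + 1 = 4 * h + 4 + 1 by ring,
    show 2 * (h + 1 + 1) = 2 * (h + 1) + 1 + 1 by ring,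
    Nat.factorial_succ (4 * h + 4), Nat.factorial_succ (2 * (h + 1) + 1),
    Nat.factorial_succ (2 * (h + 1)),
    Nat.factorial_succ (h + 1), Nat.factorial_succ h]
  push_cast
  field_simp
  ring

open PowerSeries in
theorem mk_centralCatalan₁ : mk centralCatalan₁ = quarticBinomialSeries 2 := by
  ext h
  simp [quarticBinomialSeries, centralCatalan₁_eq]

open PowerSeries in
theorem mk_centralCatalan₂ :
    mk centralCatalan₂ = quarticBinomialSeries 1 - 2 * (X * quarticBinomialSeries 4) := by
  have h2 : (2 : PowerSeries ℚ) = C 2 := (map_ofNat C 2).symm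
  ext h
  rw [h2, map_sub, coeff_C_mul]
  cases h with
  | zero => simp [quarticBinomialSeries, centralCatalan₂_zero]
  | succ h =>
    rw [coeff_succ_X_mul]
    simp only [quarticBinomialSeries, coeff_mk, centralCatalan₂_succ]

open PowerSeries in
theorem two_mul_mk_centralCatalan₃ : 2 * mk centralCatalan₃ = quarticBinomialSeries 0 := by
  have h2 : (2 : PowerSeries ℚ) = C 2 := (map_ofNat C 2).symm
  ext h
  rw [h2, coeff_C_mul]
  simp [quarticBinomialSeries, centralCatalan₃_eq]

open PowerSeries in
theorem mk_centralCatalan₄ : mk centralCatalan₄ = quarticBinomialSeries 1 := by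
  ext h
  simp [quarticBinomialSeries, centralCatalan₄_eq]

open PowerSeries in
theorem coeff_mk_mul_mk_eq_sum_range (f g : ℕ → ℚ) (n : ℕ) :
    coeff n (mk f * mk g) = ∑ j ∈ Finset.range (n + 1), f j * g (n - j) := by
  rw [coeff_mul, Finset.Nat.sum_antidiagonal_eq_sum_range_succ_mk]
  simp

open PowerSeries in
theorem centralCatalan_series_identity₁ :
    4 * (mk centralCatalan₃ * mk centralCatalan₃)
      = 1 + 8 * (X * (mk centralCatalan₂ * mk centralCatalan₁)) := by
  have h12 := quarticBinomialSeries_mul_succ 0 2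
  have h33 := quarticBinomialSeries_mul_succ 3 2
  simp only [Nat.reduceAdd] at h12 h33
  have hsq : (quarticBinomialSeries 0 - 4 * (X * quarticBinomialSeries 3)) ^ 2 = 1 := by
    rw [quarticBinomialSeries_zero]
    ring
  rw [mk_centralCatalan₁, mk_centralCatalan₂]
  -- Expanding `hsq` gives the terms `B_0 B_3` and `B_3 ^ 2`, which become `B_1 B_2` and `B_4 B_2`.
  linear_combination hsq + 8 * X * h12 - 16 * X ^ 2 * h33
    + (2 * mk centralCatalan₃ + quarticBinomialSeries 0) * two_mul_mk_centralCatalan₃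

open PowerSeries in
theorem centralCatalan_series_identity₂ :
    mk centralCatalan₃ * mk centralCatalan₄
      = mk centralCatalan₂ * mk centralCatalan₃
        + X * (mk centralCatalan₁ * mk centralCatalan₁) := by
  have h13 := quarticBinomialSeries_mul_succ 0 3
  have h22 := quarticBinomialSeries_mul_succ 1 2
  simp only [Nat.reduceAdd] at h13 h22
  rw [mk_centralCatalan₁, mk_centralCatalan₂, mk_centralCatalan₄]
  linear_combination X * h13 + X * h22
    + X * quarticBinomialSeries 4 * two_mul_mk_centralCatalan₃

open PowerSeries in
theorem centralCatalan_series_identity₃ :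
    mk centralCatalan₄ * mk centralCatalan₄
      = 2 * (mk centralCatalan₃ * mk centralCatalan₁) := by
  have h11 := quarticBinomialSeries_mul_succ 0 1
  simp only [Nat.reduceAdd] at h11
  rw [mk_centralCatalan₁, mk_centralCatalan₄]
  linear_combination -h11 - quarticBinomialSeries 2 * two_mul_mk_centralCatalan₃

theorem corollaryC (h : ℕ) (hh : 0 < h) :
    (∑ j ∈ Finset.range (h + 1), centralCatalan₃ j * centralCatalan₃ (h - j)
      = 2 * ∑ j ∈ Finset.range h, centralCatalan₂ j * centralCatalan₁ (h - 1 - j)) ∧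
    (∑ j ∈ Finset.range (h + 1), centralCatalan₃ j * centralCatalan₄ (h - j)
      = ∑ j ∈ Finset.range (h + 1), centralCatalan₂ j * centralCatalan₃ (h - j)
        + ∑ j ∈ Finset.range h, centralCatalan₁ j * centralCatalan₁ (h - 1 - j)) ∧
    (∑ j ∈ Finset.range (h + 1), centralCatalan₄ j * centralCatalan₄ (h - j)
      = 2 * ∑ j ∈ Finset.range (h + 1), centralCatalan₃ j * centralCatalan₁ (h - j)) := by
  obtain ⟨n, rfl⟩ : ∃ n, h = n + 1 := ⟨h - 1, by omega⟩
  have h2 : (2 : PowerSeries ℚ) = PowerSeries.C 2 := (map_ofNat PowerSeries.C 2).symm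
  have h4 : (4 : PowerSeries ℚ) = PowerSeries.C 4 := (map_ofNat PowerSeries.C 4).symm
  have h8 : (8 : PowerSeries ℚ) = PowerSeries.C 8 := (map_ofNat PowerSeries.C 8).symm
  refine ⟨?_, ?_, ?_⟩
  · have e := congrArg (PowerSeries.coeff (n + 1)) centralCatalan_series_identity₁
    -- The constant 1 contributes only in degree 0, so it drops out for positive `h`.
    rw [h4, h8, map_add, PowerSeries.coeff_C_mul, PowerSeries.coeff_C_mul,
      PowerSeries.coeff_succ_X_mul, coeff_mk_mul_mk_eq_sum_range, coeff_mk_mul_mk_eq_sum_range,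
      PowerSeries.coeff_one, if_neg (by omega)] at e
    rw [Nat.add_sub_cancel]
    linarith
  · have e := congrArg (PowerSeries.coeff (n + 1)) centralCatalan_series_identity₂
    rw [map_add, PowerSeries.coeff_succ_X_mul] at e
    simpa only [coeff_mk_mul_mk_eq_sum_range, Nat.add_sub_cancel] using e
  · have e := congrArg (PowerSeries.coeff (n + 1)) centralCatalan_series_identity₃
    rw [h2, PowerSeries.coeff_C_mul] at e
    simpa only [coeff_mk_mul_mk_eq_sum_range] using e
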